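/- Let $d\ge 0$ be an integer and $L\in\mathbb{R}^d$. In the complex Hilbert space $L_2(\mathbb{R}^d)$, consider the operators $$A_Lf(x)=2\pi\langle L,x\rangle f(x),\qquad B_Lf(x)=\frac{\mathrm{i}}{2\pi}\frac{\partial f}{\partial L}(x),\qquad \frac{\partial f}{\partial L}=\sum_{n=1}^d L_n\frac{\partial f}{\partial x_n},$$ with domains $$D(A_L)=\Big\{f\in L_2(\mathbb{R}^d):\int_{\mathbb{R}^d}\|x\|^2|f(x)|^2\,\mathrm{d}x<\infty\Big\},\qquad D(B_L)=H^1(\mathbb{R}^d)$$ (the functions in $L_2(\mathbb{R}^d)$ all of whose first order weak derivatives are in $L_2(\mathbb{R}^d)$). For $L\ne 0$ and non-zero $f\in D(A_L)\cap D(B_L)$ put $$\mathrm{UP}_L(f)=\frac{\Delta(A_L,f)\,\Delta(B_L,f)}{\|L\|^4\|f\|_2^4},\qquad \Delta(T,f)=\|Tf\|_2^2-\frac{|\langle Tf,f\rangle|^2}{\|f\|_2^2}.$$ For $k\in\mathbb{Z}_{\ge 0}$ and $y\in\mathbb{R}$ let $$h_k(y)=(-1)^k(2^kk!\sqrt{\pi})^{-1/2}\,\mathrm{e}^{y^2/2}\frac{\mathrm{d}^k}{\mathrm{d}y^k}\mathrm{e}^{-y^2},$$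 and for $\alpha\in\mathbb{Z}_{\ge 0}^d$ let $h_\alpha(x)=h_{\alpha_1}(x_1)\cdots h_{\alpha_d}(x_d)$. Let $f\in D(A_L)\cap D(B_L)$ satisfy $\langle A_Lf,f\rangle=\langle B_Lf,f\rangle=0$. Then $f$ has exactly one Fourier–Hermite expansion $f=\sum_{\alpha\in\mathbb{Z}_{\ge 0}^d}c_\alpha h_\alpha$ with complex coefficients, converging unconditionally in $L_2(\mathbb{R}^d)$. Moreover, with $e_n$ the $n$-th unit vector and $c_{\alpha-e_n}:=0$ when $\alpha_n=0$, its coefficients satisfy $$(2\pi)^{-2}\|A_Lf\|_2^2+(2\pi)^2\|B_Lf\|_2^2=\sum_{\alpha\in\mathbb{Z}_{\ge 0}^d}\left(\Big|\sum_{n=1}^dL_n\sqrt{\alpha_n}\,c_{\alpha-e_n}\Big|^2+\Big|\sum_{n=1}^dL_n\sqrt{\alpha_n+1}\,c_{\alpha+e_n}\Big|^2\right),$$ the two series $$S_\pm=\sum_{\alpha\in\mathbb{Z}_{\ge 0}^d}\Big|\sum_{n=1}^dL_n\left(\sqrt{\alpha_n}\,c_{\alpha-e_n}\pm\sqrt{\alpha_n+1}\,c_{\alpha+e_n}\right)\Big|^2$$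 converge, and, if $L\ne 0$ and $f\neq 0$, $$\mathrm{UP}_L(f)=\frac{\|A_Lf\|_2^2\,\|B_Lf\|_2^2}{\|L\|^4\|f\|_2^4}=\frac{1}{4\|L\|^4\|f\|_2^4}\,S_+\,S_-.$$ -/

import Mathlib

open MeasureTheory
open scoped SchwartzMap LineDeriv Nat

noncomputable section

/-! ### The Hilbert space and generalities on operators -/

/-- The complex Hilbert space `L₂(ℝᵈ)`, for Lebesgue measure. -/
abbrev L2 (d : ℕ) : Type := Lp ℂ 2 (volume : Measure (EuclideanSpace ℝ (Fin d)))

/-- The variance `Δ(T, f) = ‖T f‖² - |⟨T f, f⟩|² / ‖f‖²` of (a non-zero) `f ∈ D(T)` with respect to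
a linear operator `T` with domain `D(T)` in a Hilbert space. Mathlib's `inner ℂ f g` is linear in
`g`, so it is `⟨g, f⟩` when the inner product is taken linear in the first entry. -/
def variance {H : Type*} [NormedAddCommGroup H] [InnerProductSpace ℂ H]
    (T : H →ₗ.[ℂ] H) (f : T.domain) : ℝ :=
  ‖T f‖ ^ 2 - ‖inner ℂ (f : H) (T f)‖ ^ 2 / ‖(f : H)‖ ^ 2

/-! ### The multiplication operator `A_L f (x) = 2π ⟨L, x⟩ f(x)` -/

section OperatorA

variable {d : ℕ}

theorem integrable_weight_iff (f : L2 d) :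
    Integrable (fun x : EuclideanSpace ℝ (Fin d) => ‖x‖ ^ 2 * ‖f x‖ ^ 2) ↔
      MemLp (fun x : EuclideanSpace ℝ (Fin d) => (‖x‖ : ℂ) * f x) 2 := by
  have hm : AEStronglyMeasurable (fun x : EuclideanSpace ℝ (Fin d) => (‖x‖ : ℂ) * f x) volume :=
    (by fun_prop : Continuous fun x : EuclideanSpace ℝ (Fin d) => (‖x‖ : ℂ)).aestronglyMeasurable.mul
      (Lp.aestronglyMeasurable f)
  rw [memLp_two_iff_integrable_sq_norm hm]
  simp [mul_pow]

/-- The domain `{f ∈ L₂(ℝᵈ) : ∫ ‖x‖² |f(x)|² dx < ∞}`. -/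
def domainA (d : ℕ) : Submodule ℂ (L2 d) where
  carrier := {f | Integrable (fun x : EuclideanSpace ℝ (Fin d) => ‖x‖ ^ 2 * ‖f x‖ ^ 2)}
  add_mem' := by
    intro f g hf hg
    simp only [Set.mem_ofPred_eq, integrable_weight_iff] at hf hg ⊢
    refine (hf.add hg).ae_eq ?_
    filter_upwards [Lp.coeFn_add f g] with x hx
    rw [hx, Pi.add_apply, Pi.add_apply, mul_add]
  zero_mem' := by
    simp only [Set.mem_ofPred_eq, integrable_weight_iff]
    refine (MemLp.zero (ε := ℂ)).ae_eq ?_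
    filter_upwards [Lp.coeFn_zero ℂ 2 (volume : Measure (EuclideanSpace ℝ (Fin d)))] with x hx
    rw [hx]
    simp
  smul_mem' := by
    intro c f hf
    simp only [Set.mem_ofPred_eq, integrable_weight_iff] at hf ⊢
    refine (hf.const_smul c).ae_eq ?_
    filter_upwards [Lp.coeFn_smul c f] with x hx
    rw [hx, Pi.smul_apply, Pi.smul_apply, smul_eq_mul, smul_eq_mul, mul_left_comm]

theorem memLp_mulInner (L : EuclideanSpace ℝ (Fin d)) (f : domainA d) :
    MemLp (fun x => ((2 * Real.pi * inner ℝ L x : ℝ) : ℂ) * (f : L2 d) x) 2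
      (volume : Measure (EuclideanSpace ℝ (Fin d))) := by
  have hf := (integrable_weight_iff (f : L2 d)).1 f.2
  refine (hf.const_smul (2 * Real.pi * ‖L‖ : ℝ)).mono ?_ (Filter.Eventually.of_forall fun x => ?_)
  · exact (by fun_prop : Continuous fun x : EuclideanSpace ℝ (Fin d) =>
      ((2 * Real.pi * inner ℝ L x : ℝ) : ℂ)).aestronglyMeasurable.mul (Lp.aestronglyMeasurable _)
  · have h := abs_real_inner_le_norm L x
    have hpi := Real.pi_pos
    simp only [norm_mul, Complex.norm_real, Real.norm_eq_abs, Pi.smul_apply, norm_smul,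
      abs_norm, abs_of_pos hpi, abs_two]
    calc 2 * Real.pi * |inner ℝ L x| * ‖(f : L2 d) x‖
        ≤ 2 * Real.pi * (‖L‖ * ‖x‖) * ‖(f : L2 d) x‖ := by gcongr
      _ = 2 * Real.pi * ‖L‖ * (‖x‖ * ‖(f : L2 d) x‖) := by ring

/-- The operator `A_L f (x) = 2π ⟨L, x⟩ f(x)` with domain `domainA d`. -/
def opA (L : EuclideanSpace ℝ (Fin d)) : L2 d →ₗ.[ℂ] L2 d where
  domain := domainA d
  toFun :=
    { toFun := fun f => (memLp_mulInner L f).toLp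
        (fun x => ((2 * Real.pi * inner ℝ L x : ℝ) : ℂ) * (f : L2 d) x)
      map_add' := by
        intro f g
        rw [← MemLp.toLp_add]
        refine MemLp.toLp_congr _ _ ?_
        filter_upwards [Lp.coeFn_add (f : L2 d) (g : L2 d)] with x hx
        rw [Submodule.coe_add, hx, Pi.add_apply, Pi.add_apply, mul_add]
      map_smul' := by
        intro c f
        rw [RingHom.id_apply, ← MemLp.toLp_const_smul]
        refine MemLp.toLp_congr _ _ ?_
        filter_upwards [Lp.coeFn_smul c (f : L2 d)] with x hx
        rw [Submodule.coe_smul, hx, Pi.smul_apply, Pi.smul_apply, smul_eq_mul, smul_eq_mul,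
          mul_left_comm] }

end OperatorA

/-! ### The Sobolev space `H¹(ℝᵈ)` and the operator `B_L f = (i / 2π) ∂f/∂L` -/

section OperatorB

variable {d : ℕ}

/-- `g ∈ L₂(ℝᵈ)` is the weak (distributional) derivative `∂f/∂x_j` of `f ∈ L₂(ℝᵈ)`. -/
def HasWeakPartial (j : Fin d) (f g : L2 d) : Prop :=
  ∂_{EuclideanSpace.single j (1 : ℝ)} (f : 𝓢'(EuclideanSpace ℝ (Fin d), ℂ)) =
    (g : 𝓢'(EuclideanSpace ℝ (Fin d), ℂ))

/-- Being a weak derivative, spelled out: `∫ u ∂f/∂x_j = -∫ ∂u/∂x_j f` for all test functions. -/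
theorem hasWeakPartial_iff (j : Fin d) (f g : L2 d) :
    HasWeakPartial j f g ↔ ∀ u : 𝓢(EuclideanSpace ℝ (Fin d), ℂ),
      ∫ x, u x * g x = - ∫ x, (fderiv ℝ u x (EuclideanSpace.single j 1)) * f x := by
  constructor
  · intro h u
    have := DFunLike.congr_fun h u
    simp only [TemperedDistribution.lineDerivOp_apply_apply, map_neg,
      Lp.toTemperedDistribution_apply, SchwartzMap.lineDerivOp_apply_eq_fderiv, smul_eq_mul] at this
    exact this.symm
  · intro h
    ext u
    have := h u
    simp only [TemperedDistribution.lineDerivOp_apply_apply, map_neg,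
      Lp.toTemperedDistribution_apply, SchwartzMap.lineDerivOp_apply_eq_fderiv, smul_eq_mul]
    exact this.symm

theorem HasWeakPartial.unique {j : Fin d} {f g h : L2 d} (hg : HasWeakPartial j f g)
    (hh : HasWeakPartial j f h) : g = h :=
  LinearMap.ker_eq_bot.1 (Lp.ker_toTemperedDistributionCLM_eq_bot (F := ℂ) (p := 2)
    (μ := (volume : Measure (EuclideanSpace ℝ (Fin d))))) (Eq.trans (Eq.symm hg) hh)

theorem HasWeakPartial.add {j : Fin d} {f f' g g' : L2 d} (h : HasWeakPartial j f g)
    (h' : HasWeakPartial j f' g') : HasWeakPartial j (f + f') (g + g') := by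
  unfold HasWeakPartial at *
  simp only [← Lp.toTemperedDistributionCLM_apply, map_add] at *
  rw [LineDeriv.lineDerivOp_add, h, h']

theorem HasWeakPartial.smul {j : Fin d} {f g : L2 d} (c : ℂ) (h : HasWeakPartial j f g) :
    HasWeakPartial j (c • f) (c • g) := by
  unfold HasWeakPartial at *
  simp only [← Lp.toTemperedDistributionCLM_apply, map_smul] at *
  rw [LineDeriv.lineDerivOp_smul, h]

/-- The Sobolev space `H¹(ℝᵈ)`: the functions in `L₂(ℝᵈ)` all of whose first order weak derivatives
are in `L₂(ℝᵈ)`. -/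
def sobolevH1 (d : ℕ) : Submodule ℂ (L2 d) where
  carrier := {f | ∀ j : Fin d, ∃ g : L2 d, HasWeakPartial j f g}
  add_mem' := fun hf hg j =>
    let ⟨f', hf'⟩ := hf j
    let ⟨g', hg'⟩ := hg j
    ⟨f' + g', hf'.add hg'⟩
  zero_mem' := fun j => ⟨0, by
    simp [HasWeakPartial, ← Lp.toTemperedDistributionCLM_apply, LineDeriv.lineDerivOp_zero]⟩
  smul_mem' := fun c f hf j => let ⟨f', hf'⟩ := hf j; ⟨c • f', hf'.smul c⟩

/-- The weak derivative `∂f/∂x_j ∈ L₂(ℝᵈ)` of `f ∈ H¹(ℝᵈ)`. -/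
def weakPartial (j : Fin d) (f : sobolevH1 d) : L2 d := (f.2 j).choose

theorem hasWeakPartial_weakPartial (j : Fin d) (f : sobolevH1 d) :
    HasWeakPartial j (f : L2 d) (weakPartial j f) := (f.2 j).choose_spec

theorem weakPartial_add (j : Fin d) (f g : sobolevH1 d) :
    weakPartial j (f + g) = weakPartial j f + weakPartial j g :=
  (hasWeakPartial_weakPartial j (f + g)).unique
    ((hasWeakPartial_weakPartial j f).add (hasWeakPartial_weakPartial j g))

theorem weakPartial_smul (j : Fin d) (c : ℂ) (f : sobolevH1 d) :
    weakPartial j (c • f) = c • weakPartial j f :=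
  (hasWeakPartial_weakPartial j (c • f)).unique ((hasWeakPartial_weakPartial j f).smul c)

/-- The operator `B_L f = (i / 2π) ∂f/∂L`, where `∂f/∂L = ∑ L_j ∂f/∂x_j`, with domain `H¹(ℝᵈ)`. -/
def opB (L : EuclideanSpace ℝ (Fin d)) : L2 d →ₗ.[ℂ] L2 d where
  domain := sobolevH1 d
  toFun :=
    { toFun := fun f => (Complex.I / (2 * Real.pi)) • ∑ j, (L j : ℂ) • weakPartial j f
      map_add' := by
        intro f g
        simp only [weakPartial_add, smul_add, Finset.sum_add_distrib]
      map_smul' := by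
        intro c f
        simp only [weakPartial_smul, RingHom.id_apply, Finset.smul_sum, smul_smul]
        refine Finset.sum_congr rfl fun j _ => ?_
        congr 1
        ring }

end OperatorB

/-- The directional uncertainty product `UP_L(f) = Δ(A_L, f) Δ(B_L, f) / (‖L‖⁴ ‖f‖⁴)` of a non-zero
`f ∈ D(A_L) ∩ D(B_L)` along a direction `L ≠ 0`. -/
def directionalUP {d : ℕ} (L : EuclideanSpace ℝ (Fin d)) (f : L2 d)
    (hA : f ∈ (opA L).domain) (hB : f ∈ (opB L).domain) : ℝ :=
  variance (opA L) ⟨f, hA⟩ * variance (opB L) ⟨f, hB⟩ / (‖L‖ ^ 4 * ‖f‖ ^ 4)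

/-! ### Hermite functions -/

/-- The one-dimensional Hermite function
`h_k(y) = (-1)^k (2^k k! √π)^(-1/2) exp(y²/2) D^k exp(-y²)`. -/
def hermiteFun (k : ℕ) (y : ℝ) : ℝ :=
  (-1) ^ k * (2 ^ k * (k ! : ℝ) * √Real.pi) ^ (-(1 / 2) : ℝ) * Real.exp (y ^ 2 / 2) *
    iteratedDeriv k (fun t : ℝ => Real.exp (-t ^ 2)) y

/-- The `d`-dimensional Hermite function `h_α(x) = h_{α_1}(x_1) ⋯ h_{α_d}(x_d)`. -/
def hermiteFunction {d : ℕ} (α : Fin d → ℕ) (x : EuclideanSpace ℝ (Fin d)) : ℂ :=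
  ((∏ n, hermiteFun (α n) (x n) : ℝ) : ℂ)

theorem exists_hermiteFun_eq (k : ℕ) :
    ∃ P : Polynomial ℝ, ∀ y, hermiteFun k y = P.eval y * Real.exp (-y ^ 2 / 2) := by
  have key : ∃ P : Polynomial ℝ, iteratedDeriv k (fun t : ℝ => Real.exp (-t ^ 2)) =
      fun y => P.eval y * Real.exp (-y ^ 2) := by
    induction k with
    | zero => exact ⟨1, by simp⟩
    | succ k ih =>
      obtain ⟨P, hP⟩ := ih
      refine ⟨P.derivative - 2 * Polynomial.X * P, ?_⟩
      rw [iteratedDeriv_succ, hP]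
      funext y
      have h1 : HasDerivAt (fun y : ℝ => Real.exp (-y ^ 2)) (Real.exp (-y ^ 2) * -(2 * y)) y := by
        simpa using ((hasDerivAt_pow 2 y).neg).exp
      refine (((P.hasDerivAt y).mul h1).deriv).trans ?_
      simp
      ring
  obtain ⟨P, hP⟩ := key
  refine ⟨Polynomial.C ((-1) ^ k * (2 ^ k * (k ! : ℝ) * √Real.pi) ^ (-(1 / 2) : ℝ)) * P,
    fun y => ?_⟩
  have h2 : Real.exp (y ^ 2 / 2) * Real.exp (-y ^ 2) = Real.exp (-y ^ 2 / 2) := by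
    rw [← Real.exp_add]
    congr 1
    ring
  rw [hermiteFun, hP, Polynomial.eval_mul, Polynomial.eval_C, ← h2]
  ring

theorem continuous_hermiteFun (k : ℕ) : Continuous (hermiteFun k) := by
  obtain ⟨P, hP⟩ := exists_hermiteFun_eq k
  rw [funext hP]
  fun_prop

theorem integrable_poly_mul_gaussian (P : Polynomial ℝ) :
    Integrable (fun y : ℝ => P.eval y * Real.exp (-y ^ 2)) := by
  induction P using Polynomial.induction_on' with
  | add p q hp hq =>
    refine (hp.add hq).congr (Filter.Eventually.of_forall fun y => ?_)
    simp [add_mul]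
  | monomial n a =>
    have h := (integrable_rpow_mul_exp_neg_mul_sq (b := 1) one_pos (s := n)
      (by linarith [Nat.cast_nonneg (α := ℝ) n])).const_mul a
    simpa [mul_assoc] using h

theorem integrable_hermiteFun_sq (k : ℕ) : Integrable (fun y : ℝ => hermiteFun k y ^ 2) := by
  obtain ⟨P, hP⟩ := exists_hermiteFun_eq k
  refine (integrable_poly_mul_gaussian (P ^ 2)).congr (Filter.Eventually.of_forall fun y => ?_)
  simp only [hP, mul_pow, Polynomial.eval_pow, ← Real.exp_nat_mul]
  congr 2
  push_cast
  ring

theorem memLp_hermiteFunction {d : ℕ} (α : Fin d → ℕ) :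
    MemLp (hermiteFunction α) 2 (volume : Measure (EuclideanSpace ℝ (Fin d))) := by
  have hc : Continuous (hermiteFunction α) := by
    unfold hermiteFunction
    refine Complex.continuous_ofReal.comp (continuous_finsetProd _ fun n _ => ?_)
    exact (continuous_hermiteFun _).comp (by fun_prop)
  rw [memLp_two_iff_integrable_sq_norm hc.aestronglyMeasurable]
  have h : Integrable (fun x : Fin d → ℝ => ∏ n, hermiteFun (α n) (x n) ^ 2) :=
    Integrable.fintype_prod fun n => integrable_hermiteFun_sq (α n)
  have h' := (PiLp.volume_preserving_ofLp (Fin d)).integrable_comp_of_integrable h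
  refine h'.congr (Filter.Eventually.of_forall fun x => ?_)
  simp only [hermiteFunction, Complex.norm_real, Real.norm_eq_abs, sq_abs, Function.comp_apply,
    Finset.prod_pow]

/-- The Hermite function `h_α` as an element of `L₂(ℝᵈ)`. -/
def hermiteL2 {d : ℕ} (α : Fin d → ℕ) : L2 d := (memLp_hermiteFunction α).toLp (hermiteFunction α)

/-! ### Shifted coefficients -/

/-- `c_{α - e_n}`, which is `0` by convention when `α - e_n` has a negative entry. -/
def lowerCoeff {d : ℕ} (c : (Fin d → ℕ) → ℂ) (α : Fin d → ℕ) (n : Fin d) : ℂ :=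
  if α n = 0 then 0 else c (Function.update α n (α n - 1))

/-- `c_{α + e_n}`. -/
def raiseCoeff {d : ℕ} (c : (Fin d → ℕ) → ℂ) (α : Fin d → ℕ) (n : Fin d) : ℂ :=
  c (Function.update α n (α n + 1))

end

noncomputable section

/-! ### One-dimensional Hermite functions -/

/-! In the Hermite basis, position and momentum are the sum and difference of the ladder operators.
Multiplying `h_α` by `x_n` gives `2^(-1/2) (√α_n h_{α-e_n} + √(α_n+1) h_{α+e_n})`, and
differentiating it in `x_n` gives the same with a minus sign (`coord_mul_hermiteFunction`,
`fderiv_hermiteSchwartz_single`). Moving both operators onto `h_α` inside the inner product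
expresses the coefficients of `A_L f` and `B_L f` through those of `f` (`inner_hermiteL2_opA`,
`inner_hermiteL2_opB`). Parseval then gives `S₊ = 2 (2π)^(-2) ‖A_L f‖²` and `S₋ = 2 (2π)² ‖B_L f‖²`.
The parallelogram law turns `(S₊ + S₋) / 2` into the sum formula. The product `S₊ S₋` gives the
uncertainty product, since centring reduces both variances to squared norms.

Parseval needs the `h_α` to be a Hilbert basis (`hermiteBasis`). Orthonormality follows from
adjointness of the ladder operators. For completeness, if `f` is orthogonal to every `h_α`, then all
moments of `h_0 f` vanish, hence so does its Fourier transform, hence `h_0 f`; and `h_0` has no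
zeros. -/

theorem hasDerivAt_iteratedDeriv_exp_neg_sq (k : ℕ) (y : ℝ) :
    HasDerivAt (iteratedDeriv k (fun t : ℝ => Real.exp (-t ^ 2)))
      (iteratedDeriv (k + 1) (fun t : ℝ => Real.exp (-t ^ 2)) y) y := by
  rw [iteratedDeriv_succ]
  have h : ContDiff ℝ (k + 1 : ℕ) (fun t : ℝ => Real.exp (-t ^ 2)) := by fun_prop
  exact ((h.differentiable_iteratedDeriv k (by exact_mod_cast k.lt_succ_self)) y).hasDerivAt

/-- This is the Leibniz rule for `g' = -2 y g`, with `g` the Gaussian. The truncated `k - 1` at `k =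
0` is harmless because of the factor `k`. -/
theorem iteratedDeriv_succ_exp_neg_sq (k : ℕ) (y : ℝ) :
    iteratedDeriv (k + 1) (fun t : ℝ => Real.exp (-t ^ 2)) y =
      -2 * y * iteratedDeriv k (fun t : ℝ => Real.exp (-t ^ 2)) y -
        2 * k * iteratedDeriv (k - 1) (fun t : ℝ => Real.exp (-t ^ 2)) y := by
  induction k generalizing y with
  | zero =>
    have h1 : HasDerivAt (fun y : ℝ => Real.exp (-y ^ 2)) (Real.exp (-y ^ 2) * -(2 * y)) y := by
      simpa using ((hasDerivAt_pow 2 y).neg).exp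
    simp only [zero_add, iteratedDeriv_one, iteratedDeriv_zero, h1.deriv]
    simp
    ring
  | succ k ih =>
    have h1 := ((((hasDerivAt_id y).const_mul (-2)).mul
      (hasDerivAt_iteratedDeriv_exp_neg_sq k y)).sub
      ((hasDerivAt_iteratedDeriv_exp_neg_sq (k - 1) y).const_mul (2 * (k : ℝ))))
    have h2 := hasDerivAt_iteratedDeriv_exp_neg_sq (k + 1) y
    rw [funext ih] at h2
    rw [h2.unique h1]
    rcases k with _ | k
    · simp
      ring
    · simp
      ring

theorem hermiteFun_eq (k : ℕ) (y : ℝ) :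
    hermiteFun k y = (-1) ^ k * (√(2 ^ k * (k ! : ℝ) * √Real.pi))⁻¹ * Real.exp (y ^ 2 / 2) *
      iteratedDeriv k (fun t : ℝ => Real.exp (-t ^ 2)) y := by
  rw [hermiteFun, Real.rpow_neg (by positivity), ← Real.sqrt_eq_rpow]

theorem sqrt_hermite_norm_succ (k : ℕ) :
    √(2 ^ (k + 1) * ((k + 1) ! : ℝ) * √Real.pi) =
      √2 * √((k : ℝ) + 1) * √(2 ^ k * (k ! : ℝ) * √Real.pi) := by
  rw [← Real.sqrt_mul (by positivity), ← Real.sqrt_mul (by positivity), Nat.factorial_succ]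
  congr 1
  push_cast
  ring

/-- Expresses `h_{k+1}` with the normalising constant of `h_k`, so that identities between
consecutive derivatives of the Gaussian become identities between Hermite functions. -/
theorem sqrt_two_mul_sqrt_succ_mul_hermiteFun_succ (k : ℕ) (y : ℝ) :
    √2 * √((k : ℝ) + 1) * hermiteFun (k + 1) y =
      -((-1) ^ k * (√(2 ^ k * (k ! : ℝ) * √Real.pi))⁻¹ * Real.exp (y ^ 2 / 2) *
        iteratedDeriv (k + 1) (fun t : ℝ => Real.exp (-t ^ 2)) y) := by
  rw [hermiteFun_eq, sqrt_hermite_norm_succ, pow_succ]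
  have : √(2 ^ k * (k ! : ℝ) * √Real.pi) ≠ 0 := by positivity
  have : √((k : ℝ) + 1) ≠ 0 := by positivity
  field_simp

theorem hermiteFun_recurrence (k : ℕ) (y : ℝ) :
    √2 * y * hermiteFun k y =
      √k * hermiteFun (k - 1) y + √((k : ℝ) + 1) * hermiteFun (k + 1) y := by
  have h2 : √2 * √2 = 2 := Real.mul_self_sqrt (by norm_num)
  have h20 : √2 ≠ 0 := by positivity
  refine mul_left_cancel₀ h20 ?_
  have h := sqrt_two_mul_sqrt_succ_mul_hermiteFun_succ k y
  have h' : √2 * √k * hermiteFun (k - 1) y =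
      2 * k * ((-1) ^ (k + 1) * (√(2 ^ k * (k ! : ℝ) * √Real.pi))⁻¹ * Real.exp (y ^ 2 / 2) *
        iteratedDeriv (k - 1) (fun t : ℝ => Real.exp (-t ^ 2)) y) := by
    rcases k with _ | k
    · simp
    · rw [Nat.add_sub_cancel, hermiteFun_eq, sqrt_hermite_norm_succ]
      push_cast
      have : √(2 ^ k * (k ! : ℝ) * √Real.pi) ≠ 0 := by positivity
      have h1 : √((k : ℝ) + 1) ≠ 0 := by positivity
      have h3 : √((k : ℝ) + 1) ^ 2 = k + 1 := Real.sq_sqrt (by positivity)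
      have h4 : √2 ^ 2 = 2 := Real.sq_sqrt (by positivity)
      field_simp
      rw [h3, h4]
      ring
  rw [iteratedDeriv_succ_exp_neg_sq] at h
  rw [pow_succ] at h'
  rw [hermiteFun_eq k]
  linear_combination -h - h' + ((-1) ^ k * (√(2 ^ k * (k ! : ℝ) * √Real.pi))⁻¹ *
      Real.exp (y ^ 2 / 2) * iteratedDeriv k (fun t : ℝ => Real.exp (-t ^ 2)) y) * y * h2

/-- The product rule gives `h_k' = y h_k - √2 √(k+1) h_{k+1}`; the recurrence then eliminates `y
h_k`. -/
theorem hasDerivAt_hermiteFun (k : ℕ) (y : ℝ) :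
    HasDerivAt (hermiteFun k)
      ((√2)⁻¹ * (√k * hermiteFun (k - 1) y - √((k : ℝ) + 1) * hermiteFun (k + 1) y)) y := by
  have h2 : √2 * √2 = 2 := Real.mul_self_sqrt (by norm_num)
  have h20 : √2 ≠ 0 := by positivity
  have h1 : HasDerivAt (fun y : ℝ => Real.exp (y ^ 2 / 2)) (Real.exp (y ^ 2 / 2) * y) y := by
    simpa using ((hasDerivAt_pow 2 y).div_const 2).exp
  have h3 := (h1.const_mul ((-1) ^ k * (√(2 ^ k * (k ! : ℝ) * √Real.pi))⁻¹)).mul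
    (hasDerivAt_iteratedDeriv_exp_neg_sq k y)
  rw [show hermiteFun k = _ from funext (hermiteFun_eq k)]
  refine h3.congr_deriv ?_
  have hs := sqrt_two_mul_sqrt_succ_mul_hermiteFun_succ k y
  have hr := hermiteFun_recurrence k y
  rw [eq_sub_of_add_eq hr.symm, inv_mul_eq_div, eq_div_iff h20]
  rw [hermiteFun_eq k]
  linear_combination √2 * hs - (√((k : ℝ) + 1) * hermiteFun (k + 1) y) * h2

theorem integrable_hermiteFun_mul (j k : ℕ) :
    Integrable (fun y : ℝ => hermiteFun j y * hermiteFun k y) := by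
  have h (k : ℕ) : MemLp (hermiteFun k) 2 volume :=
    (memLp_two_iff_integrable_sq (continuous_hermiteFun k).aestronglyMeasurable).2
      (integrable_hermiteFun_sq k)
  exact (h j).integrable_mul (h k)

theorem integral_hermiteFun_zero_sq : ∫ y : ℝ, hermiteFun 0 y * hermiteFun 0 y = 1 := by
  have hpi : √Real.pi ≠ 0 := by positivity
  have h (y : ℝ) : hermiteFun 0 y * hermiteFun 0 y = (√Real.pi)⁻¹ * Real.exp (-1 * y ^ 2) := by
    have h1 : Real.exp (y ^ 2 / 2) * Real.exp (y ^ 2 / 2) * Real.exp (-y ^ 2) = 1 := by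
      rw [← Real.exp_add, ← Real.exp_add, ← Real.exp_zero]
      congr 1
      ring
    have h2 : (√(√Real.pi))⁻¹ * (√(√Real.pi))⁻¹ = (√Real.pi)⁻¹ := by
      rw [← mul_inv, Real.mul_self_sqrt (by positivity)]
    simp only [hermiteFun_eq, iteratedDeriv_zero, pow_zero, Nat.factorial_zero, Nat.cast_one,
      one_mul, neg_mul]
    linear_combination (√(√Real.pi))⁻¹ * (√(√Real.pi))⁻¹ * Real.exp (-y ^ 2) * h1 +
      Real.exp (-y ^ 2) * h2
  simp_rw [h]
  rw [integral_const_mul, integral_gaussian, div_one, inv_mul_cancel₀ hpi]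

/-- Creation and annihilation operators are adjoint to each other. -/
theorem sqrt_succ_mul_integral_hermiteFun_succ_mul (j k : ℕ) :
    √((k : ℝ) + 1) * ∫ y : ℝ, hermiteFun (k + 1) y * hermiteFun j y =
      √j * ∫ y : ℝ, hermiteFun k y * hermiteFun (j - 1) y := by
  have hI := integrable_hermiteFun_mul
  set dh : ℕ → ℝ → ℝ := fun k y =>
    (√2)⁻¹ * (√k * hermiteFun (k - 1) y - √((k : ℝ) + 1) * hermiteFun (k + 1) y) with hdh
  have hdI (j k : ℕ) : Integrable (fun y => hermiteFun j y * dh k y) := by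
    have := (((hI j (k - 1)).const_mul (√k)).sub ((hI j (k + 1)).const_mul
      √((k : ℝ) + 1))).const_mul (√2)⁻¹
    refine this.congr (Filter.Eventually.of_forall fun y => ?_)
    simp only [hdh, Pi.sub_apply]
    ring
  have hdI' (j k : ℕ) : Integrable (fun y => dh k y * hermiteFun j y) := by
    simpa only [mul_comm] using hdI j k
  have hp : ∫ y, hermiteFun k y * dh j y = - ∫ y, dh k y * hermiteFun j y :=
    integral_mul_deriv_eq_deriv_mul_of_integrable
      (fun y _ => hasDerivAt_hermiteFun k y) (fun y _ => hasDerivAt_hermiteFun j y)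
      (hdI k j) (hdI' j k) (hI k j)
  have h2 : √2 * √2 = 2 := Real.mul_self_sqrt (by norm_num)
  have h20 : √2 ≠ 0 := by positivity
  rw [← integral_const_mul, ← integral_const_mul, ← sub_eq_zero, ← integral_sub
    ((hI _ _).const_mul _) ((hI _ _).const_mul _)]
  have h0 : ∫ y, (hermiteFun k y * dh j y + dh k y * hermiteFun j y) = 0 := by
    rw [integral_add (hdI k j) (hdI' j k), hp, neg_add_cancel]
  -- Since `√(k+1) h_{k+1} = (y h_k - h_k') / √2` and `√j h_{j-1} = (y h_j + h_j') / √2`, the terms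
  -- in `y` cancel and a multiple of the total derivative `(h_k h_j)'` remains.
  have h (y : ℝ) : √((k : ℝ) + 1) * (hermiteFun (k + 1) y * hermiteFun j y) -
      √j * (hermiteFun k y * hermiteFun (j - 1) y) =
      -(√2)⁻¹ * (hermiteFun k y * dh j y + dh k y * hermiteFun j y) * 2⁻¹ * 2 := by
    have e1 := hermiteFun_recurrence k y
    have e2 := hermiteFun_recurrence j y
    simp only [hdh]
    have e3 : (√2)⁻¹ * (√2)⁻¹ = 2⁻¹ := by rw [← mul_inv, h2]
    linear_combination (hermiteFun k y * (√j * hermiteFun (j - 1) y -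
      √((j : ℝ) + 1) * hermiteFun (j + 1) y) + (√k * hermiteFun (k - 1) y -
      √((k : ℝ) + 1) * hermiteFun (k + 1) y) * hermiteFun j y) * e3 +
      2⁻¹ * hermiteFun k y * e2 - 2⁻¹ * hermiteFun j y * e1
  simp_rw [h]
  rw [integral_mul_const, integral_mul_const, integral_const_mul, h0]
  simp

theorem integral_hermiteFun_mul (j k : ℕ) :
    ∫ y : ℝ, hermiteFun j y * hermiteFun k y = if j = k then 1 else 0 := by
  induction j generalizing k with
  | zero =>
    rcases k with _ | k
    · simpa using integral_hermiteFun_zero_sq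
    · have h := sqrt_succ_mul_integral_hermiteFun_succ_mul 0 k
      have h1 : √((k : ℝ) + 1) ≠ 0 := by positivity
      simp only [mul_comm (hermiteFun 0 _)]
      simpa [h1] using h
  | succ j ih =>
    -- Adjointness lowers both indices at once; for `k = 0` the right side carries the factor `√0`.
    have h := sqrt_succ_mul_integral_hermiteFun_succ_mul k j
    have h1 : √((j : ℝ) + 1) ≠ 0 := by positivity
    rcases k with _ | k
    · simpa [h1] using h
    · rw [Nat.add_sub_cancel, ih] at h
      by_cases hjk : j = k
      · subst hjk
        simpa [h1] using h
      · simpa [hjk, h1] using h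

/-! ### Gaussians as Schwartz functions -/

theorem one_add_pow_mul_exp_neg_mul_sq_le {c : ℝ} (hc : 0 < c) (m : ℕ) {t : ℝ} (ht : 0 ≤ t) :
    (1 + t) ^ m * Real.exp (-c * t ^ 2) ≤ m ! * Real.exp (1 + 1 / (4 * c)) := by
  have h1 : (1 + t) ^ m ≤ m ! * Real.exp (1 + t) := by
    have := Real.pow_div_factorial_le_exp (1 + t) (by positivity) m
    rwa [div_le_iff₀ (by positivity), mul_comm] at this
  have h2 : 1 + t + -c * t ^ 2 ≤ 1 + 1 / (4 * c) := by
    have : 1 / (4 * c) - t + c * t ^ 2 = c * (t - 1 / (2 * c)) ^ 2 := by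
      field_simp
      ring
    have : 0 ≤ c * (t - 1 / (2 * c)) ^ 2 := by positivity
    linarith
  calc (1 + t) ^ m * Real.exp (-c * t ^ 2)
      ≤ m ! * Real.exp (1 + t) * Real.exp (-c * t ^ 2) := by gcongr
    _ = m ! * Real.exp (1 + t + -c * t ^ 2) := by rw [Real.exp_add (1 + t)]; ring
    _ ≤ _ := by gcongr

section Gaussian

variable {V : Type*} [NormedAddCommGroup V] [InnerProductSpace ℝ V]

/-- By the Faà di Bruno bound, each derivative is at most a polynomial in `‖x‖` times the Gaussian
itself, because `exp` is its own derivative and the exponent has temperate growth. -/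
theorem exists_pow_mul_iteratedFDeriv_gaussian_le {c : ℝ} (hc : 0 < c) (k n : ℕ) :
    ∃ C : ℝ, ∀ x : V,
      ‖x‖ ^ k * ‖iteratedFDeriv ℝ n (fun x : V => Real.exp (-c * ‖x‖ ^ 2)) x‖ ≤ C := by
  have hf : (fun x : V => -c * ‖x‖ ^ 2).HasTemperateGrowth := by fun_prop
  obtain ⟨l, C₀, hC₀, hb⟩ := hf.norm_iteratedFDeriv_le_uniform n
  refine ⟨n ! * (1 + C₀) ^ n * ((k + l * n)! * Real.exp (1 + 1 / (4 * c))), fun x => ?_⟩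
  -- The constant is `1 + C₀` rather than `C₀` to force `1 ≤ D`, so that `D ≤ D ^ i` for `i ≥ 1`.
  set D : ℝ := (1 + C₀) * (1 + ‖x‖) ^ l with hD
  have h1 : 1 ≤ (1 + ‖x‖) ^ l := one_le_pow₀ (by linarith [norm_nonneg x])
  have hD1 : 1 ≤ D := by nlinarith
  have key := norm_iteratedFDeriv_comp_le (𝕜 := ℝ) (g := Real.exp) (f := fun x : V => -c * ‖x‖ ^ 2)
    (n := n) (N := n) (Real.contDiff_exp) (hf.1.of_le (mod_cast le_top)) le_rfl x
    (C := Real.exp (-c * ‖x‖ ^ 2)) (D := D)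
    (fun i _ => by
      rw [norm_iteratedFDeriv_eq_norm_iteratedDeriv, iteratedDeriv_eq_iterate,
        Real.iter_deriv_exp, Real.norm_eq_abs, Real.abs_exp])
    (fun i hi hin => by
      calc _ ≤ C₀ * (1 + ‖x‖) ^ l := hb i hin x
        _ ≤ D := by rw [hD]; gcongr; linarith
        _ ≤ D ^ i := le_self_pow₀ hD1 (by omega))
  calc _ ≤ (1 + ‖x‖) ^ k * (n ! * Real.exp (-c * ‖x‖ ^ 2) * D ^ n) := by
        gcongr
        · linarith
        · exact key
    _ = n ! * (1 + C₀) ^ n * ((1 + ‖x‖) ^ (k + l * n) * Real.exp (-c * ‖x‖ ^ 2)) := by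
        rw [hD, mul_pow, ← pow_mul, pow_add]
        ring
    _ ≤ _ := mul_le_mul_of_nonneg_left
        (one_add_pow_mul_exp_neg_mul_sq_le hc _ (norm_nonneg x)) (by positivity)

/-- The Gaussian `exp (-c ‖x‖²)` as a Schwartz function. -/
def gaussianSchwartz (V : Type*) [NormedAddCommGroup V] [InnerProductSpace ℝ V] (c : ℝ)
    (hc : 0 < c) : 𝓢(V, ℂ) where
  toFun x := (Real.exp (-c * ‖x‖ ^ 2) : ℂ)
  smooth' := Complex.ofRealCLM.contDiff.comp
    (Real.contDiff_exp.comp (contDiff_const.mul (contDiff_norm_sq ℝ)))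
  decay' k n := by
    obtain ⟨C, hC⟩ := exists_pow_mul_iteratedFDeriv_gaussian_le (V := V) hc k n
    refine ⟨C, fun x => le_trans (le_of_eq ?_) (hC x)⟩
    congr 1
    have h : ContDiff ℝ n (fun x : V => Real.exp (-c * ‖x‖ ^ 2)) :=
      Real.contDiff_exp.comp (contDiff_const.mul (contDiff_norm_sq ℝ))
    exact Complex.ofRealLI.norm_iteratedFDeriv_comp_left h.contDiffAt le_rfl

@[simp]
theorem gaussianSchwartz_apply (c : ℝ) (hc : 0 < c) (x : V) :
    gaussianSchwartz V c hc x = (Real.exp (-c * ‖x‖ ^ 2) : ℂ) := rfl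

end Gaussian

/-! ### Multivariate Hermite functions -/

theorem Function.HasTemperateGrowth.polynomial_eval {V : Type*} [NormedAddCommGroup V]
    [NormedSpace ℝ V] (P : Polynomial ℝ) {g : V → ℝ} (hg : g.HasTemperateGrowth) :
    (fun x => P.eval (g x)).HasTemperateGrowth := by
  induction P using Polynomial.induction_on' with
  | add p q hp hq =>
    simp only [Polynomial.eval_add]
    exact hp.fun_add hq
  | monomial n a =>
    simp only [Polynomial.eval_monomial]
    fun_prop

theorem Function.HasTemperateGrowth.finset_prod {V ι : Type*} [NormedAddCommGroup V]
    [NormedSpace ℝ V] {g : ι → V → ℝ} (s : Finset ι) (hg : ∀ i, (g i).HasTemperateGrowth) :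
    (fun x => ∏ i ∈ s, g i x).HasTemperateGrowth := by
  classical
  induction s using Finset.induction_on with
  | empty => simp
  | insert a s ha ih =>
    simp only [Finset.prod_insert ha]
    exact (hg a).fun_mul ih

section HermiteFunction

variable {d : ℕ}

theorem EuclideanSpace.hasTemperateGrowth_coord (n : Fin d) :
    (fun x : EuclideanSpace ℝ (Fin d) => x n).HasTemperateGrowth :=
  (EuclideanSpace.proj (𝕜 := ℝ) n).hasTemperateGrowth

/-- A polynomial times a Gaussian is Schwartz; this makes `h_α` admissible as a test function for
weak derivatives. -/
theorem exists_schwartz_eq_hermiteFunction (α : Fin d → ℕ) :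
    ∃ u : 𝓢(EuclideanSpace ℝ (Fin d), ℂ), ∀ x, u x = hermiteFunction α x := by
  choose P hP using exists_hermiteFun_eq
  have hg : (fun x : EuclideanSpace ℝ (Fin d) =>
      ((∏ n, (P (α n)).eval (x n) : ℝ) : ℂ)).HasTemperateGrowth :=
    Function.Complex.hasTemperateGrowth_ofReal.comp (.finset_prod _ fun n =>
      (EuclideanSpace.hasTemperateGrowth_coord n).polynomial_eval _)
  refine ⟨SchwartzMap.smulLeftCLM ℂ (fun x : EuclideanSpace ℝ (Fin d) =>
      ((∏ n, (P (α n)).eval (x n) : ℝ) : ℂ)) (gaussianSchwartz _ (1 / 2) (by norm_num)),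
    fun x => ?_⟩
  rw [SchwartzMap.smulLeftCLM_apply_apply hg, hermiteFunction, gaussianSchwartz_apply, smul_eq_mul,
    ← Complex.ofReal_mul]
  congr 1
  simp only [hP, Finset.prod_mul_distrib, ← Real.exp_sum]
  congr 2
  rw [EuclideanSpace.real_norm_sq_eq, Finset.mul_sum]
  exact Finset.sum_congr rfl fun n _ => by ring

/-- The Hermite function `h_α` as a Schwartz function. -/
def hermiteSchwartz (α : Fin d → ℕ) : 𝓢(EuclideanSpace ℝ (Fin d), ℂ) :=
  (exists_schwartz_eq_hermiteFunction α).choose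

theorem hermiteSchwartz_apply (α : Fin d → ℕ) (x : EuclideanSpace ℝ (Fin d)) :
    hermiteSchwartz α x = hermiteFunction α x :=
  (exists_schwartz_eq_hermiteFunction α).choose_spec x

theorem hermiteFunction_eq_mul_prod_erase (α : Fin d → ℕ) (n : Fin d)
    (x : EuclideanSpace ℝ (Fin d)) :
    hermiteFunction α x = (hermiteFun (α n) (x n) : ℂ) *
      ((∏ m ∈ Finset.univ.erase n, hermiteFun (α m) (x m) : ℝ) : ℂ) := by
  rw [hermiteFunction, ← Complex.ofReal_mul]
  exact congrArg _ (Finset.mul_prod_erase Finset.univ (fun m => hermiteFun (α m) (x m))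
    (Finset.mem_univ n)).symm

theorem hermiteFunction_update (α : Fin d → ℕ) (n : Fin d) (k : ℕ)
    (x : EuclideanSpace ℝ (Fin d)) :
    hermiteFunction (Function.update α n k) x = (hermiteFun k (x n) : ℂ) *
      ((∏ m ∈ Finset.univ.erase n, hermiteFun (α m) (x m) : ℝ) : ℂ) := by
  rw [hermiteFunction_eq_mul_prod_erase _ n, Function.update_self]
  congr 2
  exact Finset.prod_congr rfl fun m hm => by rw [Function.update_of_ne (Finset.ne_of_mem_erase hm)]

/-- Only the `n`-th factor is affected, so this is the one-dimensional recurrence. When `α n = 0`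
the truncated lower index gives `h_α` itself, with coefficient `√0`. -/
theorem coord_mul_hermiteFunction (α : Fin d → ℕ) (n : Fin d) (x : EuclideanSpace ℝ (Fin d)) :
    (x n : ℂ) * hermiteFunction α x = (√2 : ℂ)⁻¹ *
      ((√(α n : ℝ) : ℂ) * hermiteFunction (Function.update α n (α n - 1)) x +
        (√((α n : ℝ) + 1) : ℂ) * hermiteFunction (Function.update α n (α n + 1)) x) := by
  have h := congrArg Complex.ofReal (hermiteFun_recurrence (α n) (x n))
  push_cast at h
  have h2 : (√2 : ℂ) ≠ 0 := by
    exact_mod_cast (by positivity : √2 ≠ 0)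
  rw [hermiteFunction_update, hermiteFunction_update, hermiteFunction_eq_mul_prod_erase α n]
  field_simp
  linear_combination ((∏ m ∈ Finset.univ.erase n, hermiteFun (α m) (x m) : ℝ) : ℂ) * h

theorem fderiv_hermiteSchwartz_single (α : Fin d → ℕ) (n : Fin d)
    (x : EuclideanSpace ℝ (Fin d)) :
    fderiv ℝ (hermiteSchwartz α) x (EuclideanSpace.single n 1) = (√2 : ℂ)⁻¹ *
      ((√(α n : ℝ) : ℂ) * hermiteFunction (Function.update α n (α n - 1)) x -
        (√((α n : ℝ) + 1) : ℂ) * hermiteFunction (Function.update α n (α n + 1)) x) := by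
  rw [← ((hermiteSchwartz α).differentiableAt.lineDeriv_eq_fderiv)]
  refine HasLineDerivAt.lineDeriv ?_
  have h : HasDerivAt (fun t : ℝ => (hermiteFun (α n) (x n + t) : ℂ)) _ 0 :=
    (HasDerivAt.comp_const_add (x n) 0
      (by simpa using hasDerivAt_hermiteFun (α n) (x n))).ofReal_comp
  have h' := h.mul_const ((∏ m ∈ Finset.univ.erase n, hermiteFun (α m) (x m) : ℝ) : ℂ)
  rw [hermiteFunction_update, hermiteFunction_update]
  refine HasDerivAt.congr_deriv (h'.congr_of_eventuallyEq (Filter.Eventually.of_forall fun t => ?_))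
    ?_
  · simp only [hermiteSchwartz_apply]
    rw [hermiteFunction_eq_mul_prod_erase α n]
    simp only [PiLp.add_apply, PiLp.smul_apply, PiLp.single_apply, smul_eq_mul]
    congr 2
    · simp
    · refine Finset.prod_congr rfl fun m hm => ?_
      simp [Finset.ne_of_mem_erase hm]
  · push_cast
    ring

theorem integral_hermiteFunction_mul (α β : Fin d → ℕ) :
    ∫ x : EuclideanSpace ℝ (Fin d), hermiteFunction α x * hermiteFunction β x =
      if α = β then 1 else 0 := by
  have h1 : ∫ x : EuclideanSpace ℝ (Fin d), hermiteFunction α x * hermiteFunction β x =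
      ∫ x : Fin d → ℝ, ((∏ n, hermiteFun (α n) (x n) * hermiteFun (β n) (x n) : ℝ) : ℂ) := by
    rw [← (PiLp.volume_preserving_ofLp (Fin d)).integral_comp
      (MeasurableEquiv.toLp 2 (Fin d → ℝ)).symm.measurableEmbedding]
    refine integral_congr_ae (Filter.Eventually.of_forall fun x => ?_)
    simp only [hermiteFunction, Finset.prod_mul_distrib, Complex.ofReal_mul]
  rw [h1, integral_complex_ofReal, integral_fintype_prod_volume_eq_prod
    (f := fun n (y : ℝ) => hermiteFun (α n) y * hermiteFun (β n) y)]
  simp only [integral_hermiteFun_mul]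
  split_ifs with h
  · subst h
    simp
  · obtain ⟨n, hn⟩ := Function.ne_iff.1 h
    rw [Finset.prod_eq_zero (Finset.mem_univ n) (by rw [if_neg hn]), Complex.ofReal_zero]

theorem conj_hermiteFunction (α : Fin d → ℕ) (x : EuclideanSpace ℝ (Fin d)) :
    (starRingEnd ℂ) (hermiteFunction α x) = hermiteFunction α x := by
  rw [hermiteFunction, Complex.conj_ofReal]

theorem inner_hermiteL2 (α : Fin d → ℕ) (f : L2 d) :
    inner ℂ (hermiteL2 α) f = ∫ x, hermiteFunction α x * f x := by
  rw [L2.inner_def]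
  refine integral_congr_ae ?_
  filter_upwards [(memLp_hermiteFunction α).coeFn_toLp] with x hx
  rw [hermiteL2, hx, RCLike.inner_apply, conj_hermiteFunction, mul_comm]

theorem orthonormal_hermiteL2 : Orthonormal ℂ (hermiteL2 (d := d)) := by
  classical
  rw [orthonormal_iff_ite]
  intro α β
  rw [inner_hermiteL2]
  refine Eq.trans (integral_congr_ae ?_) (integral_hermiteFunction_mul α β)
  filter_upwards [(memLp_hermiteFunction β).coeFn_toLp] with x hx
  rw [hermiteL2, hx]

theorem integrable_hermiteFunction_mul (α : Fin d → ℕ) (f : L2 d) :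
    Integrable (fun x => hermiteFunction α x * f x) :=
  (memLp_hermiteFunction α).integrable_mul (Lp.memLp f)

end HermiteFunction

/-! ### Completeness of the Hermite functions -/

section Completeness

variable {d : ℕ}

theorem coord_mul_mem_span_hermiteFunction (n : Fin d) {g : EuclideanSpace ℝ (Fin d) → ℂ}
    (hg : g ∈ Submodule.span ℂ (Set.range (hermiteFunction (d := d)))) :
    (fun x => (x n : ℂ) * g x) ∈ Submodule.span ℂ (Set.range (hermiteFunction (d := d))) := by
  induction hg using Submodule.span_induction with
  | mem g hg =>
    obtain ⟨α, rfl⟩ := hg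
    have h (β : Fin d → ℕ) : hermiteFunction β ∈
        Submodule.span ℂ (Set.range (hermiteFunction (d := d))) :=
      Submodule.subset_span ⟨β, rfl⟩
    rw [funext (coord_mul_hermiteFunction α n)]
    exact Submodule.smul_mem _ _ (Submodule.add_mem _ (Submodule.smul_mem _ _ (h _))
      (Submodule.smul_mem _ _ (h _)))
  | zero =>
    convert Submodule.zero_mem (Submodule.span ℂ (Set.range (hermiteFunction (d := d)))) using 1
    funext x
    simp
  | add g g' _ _ h h' =>
    convert Submodule.add_mem _ h h' using 1
    funext x
    simp [mul_add]
  | smul c g _ h =>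
    convert Submodule.smul_mem _ c h using 1
    funext x
    simp [mul_left_comm]

theorem inner_mul_mem_span_hermiteFunction (w : EuclideanSpace ℝ (Fin d))
    {g : EuclideanSpace ℝ (Fin d) → ℂ}
    (hg : g ∈ Submodule.span ℂ (Set.range (hermiteFunction (d := d)))) :
    (fun x => ((inner ℝ x w : ℝ) : ℂ) * g x) ∈
      Submodule.span ℂ (Set.range (hermiteFunction (d := d))) := by
  have h := Submodule.sum_mem (Submodule.span ℂ (Set.range (hermiteFunction (d := d))))
    (fun n (_ : n ∈ Finset.univ) =>
      Submodule.smul_mem _ (w n : ℂ) (coord_mul_mem_span_hermiteFunction n hg))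
  convert h using 1
  funext x
  simp only [Finset.sum_apply, Pi.smul_apply, smul_eq_mul, PiLp.inner_apply, RCLike.inner_apply,
    conj_trivial, Complex.ofReal_sum, Complex.ofReal_mul, Finset.sum_mul, mul_assoc]

/-- The recurrence makes the span stable under multiplication by coordinates. These functions are
the terms, up to scalars, of the exponential series of a plane wave times `h_0`. -/
theorem inner_pow_mul_mem_span_hermiteFunction (w : EuclideanSpace ℝ (Fin d)) (k : ℕ) :
    (fun x => ((inner ℝ x w : ℝ) : ℂ) ^ k * hermiteFunction 0 x) ∈
      Submodule.span ℂ (Set.range (hermiteFunction (d := d))) := by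
  induction k with
  | zero =>
    simp only [pow_zero, one_mul]
    exact Submodule.subset_span ⟨0, rfl⟩
  | succ k ih => simpa only [pow_succ', mul_assoc] using inner_mul_mem_span_hermiteFunction w ih

theorem integral_span_hermiteFunction_mul_eq_zero {f : L2 d}
    (hf : ∀ α, ∫ x, hermiteFunction α x * f x = 0) {g : EuclideanSpace ℝ (Fin d) → ℂ}
    (hg : g ∈ Submodule.span ℂ (Set.range (hermiteFunction (d := d)))) :
    Integrable (fun x => g x * f x) ∧ ∫ x, g x * f x = 0 := by
  induction hg using Submodule.span_induction with
  | mem g hg =>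
    obtain ⟨α, rfl⟩ := hg
    exact ⟨integrable_hermiteFunction_mul α f, hf α⟩
  | zero => simp
  | add g g' _ _ h h' =>
    simp only [Pi.add_apply, add_mul]
    exact ⟨h.1.add h'.1, by rw [integral_add h.1 h'.1, h.2, h'.2, add_zero]⟩
  | smul c g _ h =>
    simp only [Pi.smul_apply, smul_eq_mul, mul_assoc]
    exact ⟨h.1.const_mul c, by rw [integral_const_mul, h.2, mul_zero]⟩

theorem hermiteFunction_zero_eq (x : EuclideanSpace ℝ (Fin d)) :
    hermiteFunction 0 x = ((√(√Real.pi))⁻¹ ^ d * Real.exp (-(1 / 2) * ‖x‖ ^ 2) : ℝ) := by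
  have h (y : ℝ) : hermiteFun 0 y = (√(√Real.pi))⁻¹ * Real.exp (-(1 / 2) * y ^ 2) := by
    have h1 : Real.exp (y ^ 2 / 2) * Real.exp (-y ^ 2) = Real.exp (-(1 / 2) * y ^ 2) := by
      rw [← Real.exp_add]
      congr 1
      ring
    simp only [hermiteFun_eq, iteratedDeriv_zero, pow_zero, Nat.factorial_zero, Nat.cast_one,
      one_mul, ← h1, mul_assoc]
  simp only [hermiteFunction, Pi.zero_apply, h, Finset.prod_mul_distrib, Finset.prod_const,
    Finset.card_univ, Fintype.card_fin, ← Real.exp_sum, ← Finset.mul_sum,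
    EuclideanSpace.real_norm_sq_eq]

/-- Supplies the dominating function for termwise integration. From `(a - ‖x‖/2)² ≥ 0`, half of the
Gaussian absorbs the exponential; the other half is in `L₂`, so its product with `f` is integrable.
-/
theorem integrable_exp_norm_mul_hermiteFunction_zero_mul (a : ℝ) (f : L2 d) :
    Integrable (fun x => Real.exp (a * ‖x‖) * ‖hermiteFunction 0 x * f x‖) := by
  have hc : (0 : ℝ) < 1 / 4 := by norm_num
  have hI : Integrable (fun x => gaussianSchwartz (EuclideanSpace ℝ (Fin d)) (1 / 4) hc x * f x) :=
    ((gaussianSchwartz (EuclideanSpace ℝ (Fin d)) (1 / 4) hc).memLp 2 volume).integrable_mul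
      (Lp.memLp f)
  refine (hI.norm.const_mul (Real.exp (a ^ 2) * (√(√Real.pi))⁻¹ ^ d)).mono' ?_
    (Filter.Eventually.of_forall fun x => ?_)
  · exact (by fun_prop : Continuous fun x : EuclideanSpace ℝ (Fin d) =>
      Real.exp (a * ‖x‖)).aestronglyMeasurable.mul
      (integrable_hermiteFunction_mul 0 f).aestronglyMeasurable.norm
  · have h1 : Real.exp (a * ‖x‖) * Real.exp (-(1 / 2) * ‖x‖ ^ 2) ≤
        Real.exp (a ^ 2) * Real.exp (-(1 / 4) * ‖x‖ ^ 2) := by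
      rw [← Real.exp_add, ← Real.exp_add, Real.exp_le_exp]
      nlinarith [sq_nonneg (a - ‖x‖ / 2)]
    have h2 : ‖hermiteFunction 0 x‖ = (√(√Real.pi))⁻¹ ^ d * Real.exp (-(1 / 2) * ‖x‖ ^ 2) := by
      rw [hermiteFunction_zero_eq, Complex.norm_real, Real.norm_of_nonneg (by positivity)]
    have h3 : ‖gaussianSchwartz (EuclideanSpace ℝ (Fin d)) (1 / 4) hc x‖ =
        Real.exp (-(1 / 4) * ‖x‖ ^ 2) := by
      rw [gaussianSchwartz_apply, Complex.norm_real, Real.norm_of_nonneg (by positivity)]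
    rw [Real.norm_of_nonneg (by positivity), norm_mul, norm_mul, h2, h3]
    calc _ = (Real.exp (a * ‖x‖) * Real.exp (-(1 / 2) * ‖x‖ ^ 2)) *
          ((√(√Real.pi))⁻¹ ^ d * ‖f x‖) := by ring
      _ ≤ (Real.exp (a ^ 2) * Real.exp (-(1 / 4) * ‖x‖ ^ 2)) *
          ((√(√Real.pi))⁻¹ ^ d * ‖f x‖) := by gcongr
      _ = _ := by ring

open FourierTransform in
-- Expanding the Fourier kernel in its power series and integrating term by term leaves only
-- integrals of span elements against `f`, all zero.
theorem fourier_hermiteFunction_zero_mul_eq_zero {f : L2 d}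
    (hf : ∀ α, ∫ x, hermiteFunction α x * f x = 0) (w : EuclideanSpace ℝ (Fin d)) :
    𝓕 (fun x => hermiteFunction 0 x * f x) w = 0 := by
  set z : ℂ := -2 * Real.pi * Complex.I with hz
  have hzn : ‖z‖ = 2 * Real.pi := by simp [hz, abs_of_pos Real.pi_pos]
  have hF {g : EuclideanSpace ℝ (Fin d) → ℂ} :=
    integral_span_hermiteFunction_mul_eq_zero hf (g := g)
  have hsum := hasSum_integral_of_dominated_convergence
    (μ := (volume : Measure (EuclideanSpace ℝ (Fin d))))
    (F := fun (k : ℕ) x => z ^ k / k ! *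
      (((inner ℝ x w : ℝ) : ℂ) ^ k * hermiteFunction 0 x * f x))
    (f := fun x => Complex.exp (z * (inner ℝ x w : ℝ)) * (hermiteFunction 0 x * f x))
    (fun k x => (2 * Real.pi * ‖w‖ * ‖x‖) ^ k / k ! * ‖hermiteFunction 0 x * f x‖)
    (fun k => ((hF (inner_pow_mul_mem_span_hermiteFunction w k)).1.const_mul
      _).aestronglyMeasurable)
    (fun k => Filter.Eventually.of_forall fun x => by
      have h1 : |inner ℝ x w| ≤ ‖x‖ * ‖w‖ := abs_real_inner_le_norm x w
      rw [mul_assoc (_ ^ k), norm_mul, norm_mul (_ ^ k), norm_div, norm_pow, norm_pow, hzn,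
        Complex.norm_real, Real.norm_eq_abs, Complex.norm_natCast]
      calc _ ≤ (2 * Real.pi) ^ k / k ! * ((‖x‖ * ‖w‖) ^ k * ‖hermiteFunction 0 x * f x‖) := by
            gcongr
        _ = _ := by
            rw [mul_pow _ ‖x‖, mul_pow _ ‖w‖, mul_pow _ ‖w‖]
            ring)
    (Filter.Eventually.of_forall fun x => (Real.summable_pow_div_factorial _).mul_right _)
    (by
      refine (integrable_exp_norm_mul_hermiteFunction_zero_mul (2 * Real.pi * ‖w‖) f).congr
        (Filter.Eventually.of_forall fun x => ?_)
      simp only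
      rw [tsum_mul_right, Real.exp_eq_exp_ℝ, NormedSpace.exp_eq_tsum_div])
    (Filter.Eventually.of_forall fun x => by
      have h := (NormedSpace.exp_series_hasSum_exp' (𝕂 := ℂ) (z * (inner ℝ x w : ℝ))).mul_right
        (hermiteFunction 0 x * f x)
      rw [← Complex.exp_eq_exp_ℂ] at h
      refine h.congr_fun fun k => ?_
      rw [smul_eq_mul, mul_pow]
      ring)
  have h0 (k : ℕ) : ∫ x, z ^ k / k ! *
      (((inner ℝ x w : ℝ) : ℂ) ^ k * hermiteFunction 0 x * f x) = 0 := by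
    rw [integral_const_mul, (hF (inner_pow_mul_mem_span_hermiteFunction w k)).2, mul_zero]
  simp only [h0] at hsum
  rw [Real.fourier_eq', ← hsum.unique hasSum_zero]
  refine integral_congr_ae (Filter.Eventually.of_forall fun x => ?_)
  simp only [smul_eq_mul]
  congr 2
  rw [hz]
  push_cast
  ring

open FourierTransform in
-- Any Schwartz `u` is `𝓕 (𝓕⁻ u)`, so the multiplication formula turns `∫ u g` into `∫ (𝓕⁻ u) (𝓕 g)
-- = 0`. Thus `g` vanishes as a tempered distribution, and `L₁` embeds injectively into these.
theorem MeasureTheory.Integrable.ae_eq_zero_of_fourier_eq_zero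
    {g : EuclideanSpace ℝ (Fin d) → ℂ} (hg : Integrable g) (h : ∀ w, 𝓕 g w = 0) :
    g =ᵐ[volume] 0 := by
  have hL1 : MemLp g 1 volume := memLp_one_iff_integrable.2 hg
  have key : Lp.toTemperedDistributionCLM ℂ (volume : Measure (EuclideanSpace ℝ (Fin d))) 1
      (hL1.toLp g) = 0 := by
    ext u
    rw [Lp.toTemperedDistributionCLM_apply, Lp.toTemperedDistribution_apply]
    have h1 : ∫ x, u x • hL1.toLp g x = ∫ x, u x • g x := by
      refine integral_congr_ae ?_
      filter_upwards [hL1.coeFn_toLp] with x hx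
      rw [hx]
    have h2 : u = 𝓕 (𝓕⁻ u) := (FourierTransform.fourier_fourierInv_eq u).symm
    have h3 := VectorFourier.integral_fourierIntegral_smul_eq_flip
      (L := innerₗ (EuclideanSpace ℝ (Fin d))) Real.continuous_fourierChar continuous_inner
      ((𝓕⁻ u).integrable (μ := volume)) hg
    rw [h1, h2, SchwartzMap.fourier_coe]
    refine Eq.trans h3 ?_
    rw [flip_innerₗ]
    have h4 (x : EuclideanSpace ℝ (Fin d)) : VectorFourier.fourierIntegral Real.fourierChar volume
      (innerₗ (EuclideanSpace ℝ (Fin d))) g x = 0 := h x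
    simp [h4]
  have h0 : hL1.toLp g = 0 := LinearMap.ker_eq_bot'.1
    (Lp.ker_toTemperedDistributionCLM_eq_bot (F := ℂ) (p := 1)
      (μ := (volume : Measure (EuclideanSpace ℝ (Fin d))))) _ key
  exact (MemLp.toLp_eq_toLp_iff hL1 MemLp.zero).1 h0

theorem eq_zero_of_inner_hermiteL2_eq_zero {f : L2 d} (hf : ∀ α, inner ℂ (hermiteL2 α) f = 0) :
    f = 0 := by
  simp only [inner_hermiteL2] at hf
  have h := (integrable_hermiteFunction_mul 0 f).ae_eq_zero_of_fourier_eq_zero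
    (fourier_hermiteFunction_zero_mul_eq_zero hf)
  rw [Lp.eq_zero_iff_ae_eq_zero]
  filter_upwards [h] with x hx
  refine (mul_eq_zero.1 hx).resolve_left ?_
  rw [hermiteFunction_zero_eq]
  refine Complex.ofReal_ne_zero.2 ?_
  positivity

/-- The Hermite functions form a Hilbert basis of `L₂(ℝᵈ)`. -/
def hermiteBasis (d : ℕ) : HilbertBasis (Fin d → ℕ) ℂ (L2 d) :=
  HilbertBasis.mkOfOrthogonalEqBot orthonormal_hermiteL2 <| by
    rw [Submodule.eq_bot_iff]
    intro f hf
    exact eq_zero_of_inner_hermiteL2_eq_zero fun α =>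
      (Submodule.mem_orthogonal _ _).1 hf _ (Submodule.subset_span ⟨α, rfl⟩)

theorem hermiteBasis_apply (α : Fin d → ℕ) : hermiteBasis d α = hermiteL2 α := by
  rw [hermiteBasis, HilbertBasis.coe_mkOfOrthogonalEqBot]

end Completeness

/-! ### Hermite coefficients of `A_L f` and `B_L f` -/

section Coefficients

variable {d : ℕ}

theorem HilbertBasis.hasSum_norm_inner_sq {ι 𝕜 E : Type*} [RCLike 𝕜] [NormedAddCommGroup E]
    [InnerProductSpace 𝕜 E] (b : HilbertBasis ι 𝕜 E) (x : E) :
    HasSum (fun i => ‖inner 𝕜 (b i) x‖ ^ 2) (‖x‖ ^ 2) := by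
  have h := (b.hasSum_inner_mul_inner x x).mapL (RCLike.reCLM (K := 𝕜))
  rw [RCLike.reCLM_apply, inner_self_eq_norm_sq] at h
  refine h.congr_fun fun i => ?_
  rw [← inner_conj_symm x, RCLike.conj_mul, ← RCLike.ofReal_pow,
    RCLike.ofReal_re]

/-- Reconciles the convention `c_{α-e_n} = 0` with truncated subtraction: the two differ only where
`√(α n) = 0`. -/
theorem sqrt_mul_lowerCoeff (c : (Fin d → ℕ) → ℂ) (α : Fin d → ℕ) (n : Fin d) :
    (√(α n : ℝ) : ℂ) * lowerCoeff c α n =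
      (√(α n : ℝ) : ℂ) * c (Function.update α n (α n - 1)) := by
  by_cases h : α n = 0 <;> simp [lowerCoeff, h]

theorem inner_hermiteL2_opA (L : EuclideanSpace ℝ (Fin d)) (f : L2 d) (hA : f ∈ (opA L).domain)
    (α : Fin d → ℕ) :
    inner ℂ (hermiteL2 α) (opA L ⟨f, hA⟩) = 2 * Real.pi * (√2 : ℂ)⁻¹ *
      ∑ n, (L n : ℂ) *
        ((√(α n : ℝ) : ℂ) * lowerCoeff (fun β => inner ℂ (hermiteL2 β) f) α n +
          (√((α n : ℝ) + 1) : ℂ) * raiseCoeff (fun β => inner ℂ (hermiteL2 β) f) α n) := by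
  simp only [sqrt_mul_lowerCoeff, raiseCoeff, inner_hermiteL2]
  have hI (β : Fin d → ℕ) := integrable_hermiteFunction_mul β f
  have h : ∫ x, hermiteFunction α x * opA L ⟨f, hA⟩ x = ∫ x, 2 * Real.pi * (√2 : ℂ)⁻¹ *
      ∑ n, (L n : ℂ) *
        ((√(α n : ℝ) : ℂ) * (hermiteFunction (Function.update α n (α n - 1)) x * f x) +
        (√((α n : ℝ) + 1) : ℂ) * (hermiteFunction (Function.update α n (α n + 1)) x * f x)) := by
    refine integral_congr_ae ?_
    filter_upwards [(memLp_mulInner L ⟨f, hA⟩).coeFn_toLp] with x hx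
    rw [show opA L ⟨f, hA⟩ x = _ from hx]
    simp only [PiLp.inner_apply, RCLike.inner_apply, conj_trivial]
    push_cast
    rw [Finset.mul_sum, Finset.mul_sum, Finset.sum_mul, Finset.mul_sum]
    refine Finset.sum_congr rfl fun n _ => ?_
    linear_combination 2 * Real.pi * (L n : ℂ) * f x * coord_mul_hermiteFunction α n x
  rw [h, integral_const_mul, integral_finsetSum _ fun n _ =>
    (((hI _).const_mul _).fun_add ((hI _).const_mul _)).const_mul _]
  congr 1
  refine Finset.sum_congr rfl fun n _ => ?_
  rw [integral_const_mul, integral_add ((hI _).const_mul _) ((hI _).const_mul _),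
    integral_const_mul, integral_const_mul]

/-- The weak derivative is tested against the Schwartz function `h_α`, which is real, so no
conjugate appears; the leading minus sign comes from the integration by parts. -/
theorem HasWeakPartial.inner_hermiteL2 {n : Fin d} {f g : L2 d} (h : HasWeakPartial n f g)
    (α : Fin d → ℕ) :
    inner ℂ (hermiteL2 α) g = -(√2 : ℂ)⁻¹ *
      ((√(α n : ℝ) : ℂ) * inner ℂ (hermiteL2 (Function.update α n (α n - 1))) f -
        (√((α n : ℝ) + 1) : ℂ) * inner ℂ (hermiteL2 (Function.update α n (α n + 1))) f) := by
  have hI (β : Fin d → ℕ) := integrable_hermiteFunction_mul β f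
  have h' := (hasWeakPartial_iff n f g).1 h (hermiteSchwartz α)
  simp only [fderiv_hermiteSchwartz_single, hermiteSchwartz_apply] at h'
  simp only [_root_.inner_hermiteL2]
  rw [h', neg_mul, ← integral_const_mul, ← integral_const_mul, ← integral_sub
    ((hI _).const_mul _) ((hI _).const_mul _), ← integral_const_mul]
  congr 1
  refine integral_congr_ae (Filter.Eventually.of_forall fun x => ?_)
  simp only
  ring

theorem inner_hermiteL2_opB (L : EuclideanSpace ℝ (Fin d)) (f : L2 d) (hB : f ∈ (opB L).domain)
    (α : Fin d → ℕ) :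
    inner ℂ (hermiteL2 α) (opB L ⟨f, hB⟩) = -(Complex.I / (2 * Real.pi) * (√2 : ℂ)⁻¹) *
      ∑ n, (L n : ℂ) *
        ((√(α n : ℝ) : ℂ) * lowerCoeff (fun β => inner ℂ (hermiteL2 β) f) α n -
          (√((α n : ℝ) + 1) : ℂ) * raiseCoeff (fun β => inner ℂ (hermiteL2 β) f) α n) := by
  have h : opB L ⟨f, hB⟩ =
    (Complex.I / (2 * Real.pi)) • ∑ j, (L j : ℂ) • weakPartial j ⟨f, hB⟩ := rfl
  simp only [sqrt_mul_lowerCoeff, raiseCoeff]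
  rw [h, inner_smul_right, inner_sum, Finset.mul_sum, Finset.mul_sum]
  refine Finset.sum_congr rfl fun n _ => ?_
  rw [inner_smul_right, (hasWeakPartial_weakPartial n ⟨f, hB⟩).inner_hermiteL2]
  ring

/-- Parseval for `A_L f`; the constant is the inverse of `|2π / √2|²`. -/
theorem hasSum_normSq_sum_add (L : EuclideanSpace ℝ (Fin d)) (f : L2 d)
    (hA : f ∈ (opA L).domain) :
    HasSum (fun α : Fin d → ℕ => ‖∑ n, (L n : ℂ) *
        ((√(α n : ℝ) : ℂ) * lowerCoeff (fun β => inner ℂ (hermiteL2 β) f) α n +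
          (√((α n : ℝ) + 1) : ℂ) * raiseCoeff (fun β => inner ℂ (hermiteL2 β) f) α n)‖ ^ 2)
      (2 * ((2 * Real.pi) ^ 2)⁻¹ * ‖opA L ⟨f, hA⟩‖ ^ 2) := by
  have h := ((hermiteBasis d).hasSum_norm_inner_sq (opA L ⟨f, hA⟩)).mul_left
    (2 * ((2 * Real.pi) ^ 2)⁻¹)
  refine h.congr_fun fun α => ?_
  have hpi := Real.pi_ne_zero
  have hk : ‖(2 * Real.pi * (√2 : ℂ)⁻¹ : ℂ)‖ ^ 2 = (2 * Real.pi) ^ 2 * 2⁻¹ := by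
    rw [norm_mul, norm_mul, norm_inv, Complex.norm_real, Complex.norm_real, Real.norm_eq_abs,
      Real.norm_eq_abs, Complex.norm_ofNat, mul_pow, mul_pow, inv_pow, sq_abs, sq_abs,
      Real.sq_sqrt (by norm_num), mul_pow]
  rw [hermiteBasis_apply, inner_hermiteL2_opA, norm_mul, mul_pow ‖_‖, hk]
  field_simp

theorem hasSum_normSq_sum_sub (L : EuclideanSpace ℝ (Fin d)) (f : L2 d)
    (hB : f ∈ (opB L).domain) :
    HasSum (fun α : Fin d → ℕ => ‖∑ n, (L n : ℂ) *
        ((√(α n : ℝ) : ℂ) * lowerCoeff (fun β => inner ℂ (hermiteL2 β) f) α n -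
          (√((α n : ℝ) + 1) : ℂ) * raiseCoeff (fun β => inner ℂ (hermiteL2 β) f) α n)‖ ^ 2)
      (2 * (2 * Real.pi) ^ 2 * ‖opB L ⟨f, hB⟩‖ ^ 2) := by
  have h := ((hermiteBasis d).hasSum_norm_inner_sq (opB L ⟨f, hB⟩)).mul_left
    (2 * (2 * Real.pi) ^ 2)
  refine h.congr_fun fun α => ?_
  have hpi := Real.pi_ne_zero
  have hk : ‖(-(Complex.I / (2 * Real.pi) * (√2 : ℂ)⁻¹) : ℂ)‖ ^ 2 =
      ((2 * Real.pi) ^ 2)⁻¹ * 2⁻¹ := by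
    rw [norm_neg, norm_mul, norm_div, norm_mul, norm_inv, Complex.norm_real, Complex.norm_real,
      Real.norm_eq_abs, Real.norm_eq_abs, Complex.norm_ofNat, Complex.norm_I, mul_pow, div_pow,
      mul_pow, inv_pow, sq_abs, sq_abs, Real.sq_sqrt (by norm_num), mul_pow, one_pow, one_div]
  rw [hermiteBasis_apply, inner_hermiteL2_opB, norm_mul, mul_pow ‖_‖, hk]
  field_simp

theorem hasSum_hermiteL2 (f : L2 d) :
    HasSum (fun α => inner ℂ (hermiteL2 α) f • hermiteL2 α) f := by
  have h := (hermiteBasis d).hasSum_repr f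
  simpa only [HilbertBasis.repr_apply_apply, hermiteBasis_apply] using h

theorem eq_inner_hermiteL2_of_hasSum {f : L2 d} {c : (Fin d → ℕ) → ℂ}
    (h : HasSum (fun α => c α • hermiteL2 α) f) : c = fun α => inner ℂ (hermiteL2 α) f := by
  classical
  funext α
  have h1 := h.mapL (innerSL ℂ (hermiteL2 α))
  have h2 := hasSum_ite_eq α (c α)
  refine h2.unique ?_
  rw [innerSL_apply_apply] at h1
  refine h1.congr_fun fun β => ?_
  rw [innerSL_apply_apply, inner_smul_right, orthonormal_iff_ite.1 orthonormal_hermiteL2]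
  by_cases hβ : β = α
  · simp [hβ]
  · simp [hβ, Ne.symm hβ]

theorem variance_of_inner_eq_zero {H : Type*} [NormedAddCommGroup H] [InnerProductSpace ℂ H]
    {T : H →ₗ.[ℂ] H} {f : T.domain} (h : inner ℂ (f : H) (T f) = 0) :
    variance T f = ‖T f‖ ^ 2 := by
  simp [variance, h]

end Coefficients

end

theorem theorem3p5 (d : ℕ) (L : EuclideanSpace ℝ (Fin d)) (f : L2 d)
    (hA : f ∈ (opA L).domain) (hB : f ∈ (opB L).domain)
    (hA0 : inner ℂ f (opA L ⟨f, hA⟩) = 0) (hB0 : inner ℂ f (opB L ⟨f, hB⟩) = 0) :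
    (∃! c : (Fin d → ℕ) → ℂ, HasSum (fun α => c α • hermiteL2 α) f) ∧
    ∀ c : (Fin d → ℕ) → ℂ, HasSum (fun α => c α • hermiteL2 α) f →
      HasSum
        (fun α : Fin d → ℕ =>
          ‖∑ n, (L n : ℂ) * (√(α n : ℝ) : ℂ) * lowerCoeff c α n‖ ^ 2 +
          ‖∑ n, (L n : ℂ) * (√((α n : ℝ) + 1) : ℂ) * raiseCoeff c α n‖ ^ 2)
        ((2 * Real.pi) ^ (-2 : ℤ) * ‖opA L ⟨f, hA⟩‖ ^ 2 +
          (2 * Real.pi) ^ 2 * ‖opB L ⟨f, hB⟩‖ ^ 2) ∧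
      Summable (fun α : Fin d → ℕ =>
        ‖∑ n, (L n : ℂ) * ((√(α n : ℝ) : ℂ) * lowerCoeff c α n +
          (√((α n : ℝ) + 1) : ℂ) * raiseCoeff c α n)‖ ^ 2) ∧
      Summable (fun α : Fin d → ℕ =>
        ‖∑ n, (L n : ℂ) * ((√(α n : ℝ) : ℂ) * lowerCoeff c α n -
          (√((α n : ℝ) + 1) : ℂ) * raiseCoeff c α n)‖ ^ 2) ∧
      (L ≠ 0 → f ≠ 0 →
        directionalUP L f hA hB =
            ‖opA L ⟨f, hA⟩‖ ^ 2 * ‖opB L ⟨f, hB⟩‖ ^ 2 / (‖L‖ ^ 4 * ‖f‖ ^ 4) ∧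
        directionalUP L f hA hB =
          1 / (4 * ‖L‖ ^ 4 * ‖f‖ ^ 4) *
            (∑' α : Fin d → ℕ,
              ‖∑ n, (L n : ℂ) * ((√(α n : ℝ) : ℂ) * lowerCoeff c α n +
                (√((α n : ℝ) + 1) : ℂ) * raiseCoeff c α n)‖ ^ 2) *
            (∑' α : Fin d → ℕ,
              ‖∑ n, (L n : ℂ) * ((√(α n : ℝ) : ℂ) * lowerCoeff c α n -
                (√((α n : ℝ) + 1) : ℂ) * raiseCoeff c α n)‖ ^ 2)) := by

  refine ⟨⟨_, hasSum_hermiteL2 f, fun c hc => eq_inner_hermiteL2_of_hasSum hc⟩, fun c hc => ?_⟩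
  obtain rfl := eq_inner_hermiteL2_of_hasSum hc
  have hp := hasSum_normSq_sum_add L f hA
  have hm := hasSum_normSq_sum_sub L f hB
  have hpi := Real.pi_ne_zero
  refine ⟨?_, hp.summable, hm.summable, fun hL hf => ?_⟩
  -- With `a` and `b` the lowering and raising sums, `‖a + b‖² + ‖a - b‖² = 2 (‖a‖² + ‖b‖²)`, so
  -- half of `S₊ + S₋` is the required series, term by term.
  · have h := (hp.add hm).mul_left (2⁻¹ : ℝ)
    have e : (2 * Real.pi) ^ (-2 : ℤ) * ‖opA L ⟨f, hA⟩‖ ^ 2 +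
        (2 * Real.pi) ^ 2 * ‖opB L ⟨f, hB⟩‖ ^ 2 =
        2⁻¹ * (2 * ((2 * Real.pi) ^ 2)⁻¹ * ‖opA L ⟨f, hA⟩‖ ^ 2 +
          2 * (2 * Real.pi) ^ 2 * ‖opB L ⟨f, hB⟩‖ ^ 2) := by
      rw [zpow_neg, zpow_ofNat]
      ring
    rw [e]
    refine h.congr_fun fun α => ?_
    simp only [mul_add, mul_sub, Finset.sum_add_distrib, Finset.sum_sub_distrib, ← mul_assoc]
    have h := parallelogram_law_with_norm ℝ
      (∑ n, (L n : ℂ) * (√(α n : ℝ) : ℂ) *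
        lowerCoeff (fun β => inner ℂ (hermiteL2 β) f) α n)
      (∑ n, (L n : ℂ) * (√((α n : ℝ) + 1) : ℂ) *
        raiseCoeff (fun β => inner ℂ (hermiteL2 β) f) α n)
    linarith
  · have h1 : directionalUP L f hA hB =
        ‖opA L ⟨f, hA⟩‖ ^ 2 * ‖opB L ⟨f, hB⟩‖ ^ 2 / (‖L‖ ^ 4 * ‖f‖ ^ 4) := by
      rw [directionalUP, variance_of_inner_eq_zero hA0, variance_of_inner_eq_zero hB0]
    refine ⟨h1, ?_⟩
    -- The powers of `2π` cancel in `S₊ S₋ = 4 ‖A_L f‖² ‖B_L f‖²`.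
    rw [h1, hp.tsum_eq, hm.tsum_eq]
    field_simp
    ring
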